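/- For $s\in[-\infty,+\infty]$, $\lambda\in[0,1]$ and $a,b\in[0,+\infty]$ let $$M_s^{\lambda}(a,b)=\big((1-\lambda)a^s+\lambda b^s\big)^{1/s}\quad (s\notin\{-\infty,0,+\infty\}),$$ $M_{-\infty}^{\lambda}(a,b)=\min(a,b)$, $M_0^{\lambda}(a,b)=a^{1-\lambda}b^{\lambda}$, $M_{+\infty}^{\lambda}(a,b)=\max(a,b)$, with the conventions $0^s=+\infty$ and $(+\infty)^s=0$ for $s<0$, $(+\infty)^s=+\infty$ for $s>0$, $0^0=(+\infty)^0=1$ and $0\cdot(+\infty)=0$. **Borell–Brascamp–Lieb inequality.** Let $n\ge 1$, $\gamma\in[-\frac1n,+\infty]$, $\lambda\in[0,1]$, and let $f,g,h:\mathbb R^n\to[0,+\infty)$ be Lebesgue measurable functions such that neither $f$ nor $g$ vanishes identically. If $$h((1-\lambda)x+\lambda y)\ \ge\ M_{\gamma}^{\lambda}(f(x),g(y))$$ for all $x,y\in\mathbb R^n$ with $f(x)>0$ and $g(y)>0$, then $$\int_{\mathbb R^n}h\ \ge\ M_{\frac{\gamma}{1+\gamma n}}^{\lambda}\left(\int_{\mathbb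 R^n}f,\ \int_{\mathbb R^n}g\right),$$ where the integrals may be $+\infty$, and $\frac{\gamma}{1+\gamma n}$ is read as $-\infty$ if $\gamma=-\frac1n$ and as $\frac1n$ if $\gamma=+\infty$. -/

import Mathlib

open MeasureTheory
open scoped NNReal ENNReal

noncomputable section

/-- The `s`-mean `M_s^lam(a, b)` of `a, b ∈ [0, ∞]` with weight `lam ∈ [0, 1]`, for
`s ∈ [-∞, +∞]`. The arithmetic is that of `ℝ≥0∞`: for `s < 0` one has `0 ^ s = ∞`, `∞ ^ s = 0`,
and always `0 * ∞ = 0`; so for `s < 0` and `0 < lam < 1` the mean vanishes as soon as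
`a = 0` or `b = 0`. For positive finite `a, b` it is the usual real expression. -/
def sMean (s : EReal) (lam : ℝ) (a b : ℝ≥0∞) : ℝ≥0∞ :=
  open Classical in
  if s = ⊥ then min a b
  else if s = ⊤ then max a b
  else if s = 0 then a ^ (1 - lam) * b ^ lam
  else (ENNReal.ofReal (1 - lam) * a ^ s.toReal + ENNReal.ofReal lam * b ^ s.toReal)
    ^ (1 / s.toReal)

/-- The exponent `γ / (1 + γ n)` for `γ ∈ [-1/n, +∞]`, read at the two end points as a limit:
it is `-∞` for `γ = -1/n` and `1/n` for `γ = +∞`. -/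
def bblExponent (n : ℕ) (γ : EReal) : EReal :=
  open Classical in
  if γ = ⊤ then ((1 / (n : ℝ) : ℝ) : EReal)
  else if 1 + γ.toReal * (n : ℝ) = 0 then ⊥
  else ((γ.toReal / (1 + γ.toReal * (n : ℝ)) : ℝ) : EReal)

end

/-! On the line, divide `f` and `g` by their suprema `A` and `B`, and `h` by `M_γ(A, B)`. By
homogeneity the superlevel sets of the quotients satisfy the Brunn–Minkowski inclusion at every
level below `1`, so integrating over levels bounds the arithmetic mean of the normalised integrals.
Hölder's inequality `M_{γ/(1+γ)}(Au, Bv) ≤ M_γ(A, B) M_1(u, v)` restores `A` and `B`. Unbounded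
functions are reached by truncation.

Higher dimensions follow by Fubini: the inequality on slices is the hypothesis for the inner
integrals, with `s = γ/(1+nγ)` in place of `γ`. The exponents compose, `s/(1+s) = γ/(1+(n+1)γ)`, and
`γ ≥ -1/(n+1)` amounts to `s ≥ -1`.

If `lam` is an end point or one integral vanishes, fixing one point of a support leaves a similarity
in the other variable, which already gives the bound. -/

/-! ### Elementary properties of the means. -/

theorem ENNReal.rpow_le_rpow_of_nonpos_exponent {x y : ℝ≥0∞} {z : ℝ} (h : x ≤ y) (hz : z ≤ 0) :
    y ^ z ≤ x ^ z := by
  have := ENNReal.rpow_le_rpow h (neg_nonneg.2 hz)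
  rwa [ENNReal.rpow_neg, ENNReal.rpow_neg, ENNReal.inv_le_inv] at this

theorem ENNReal.ofReal_one_sub_add_ofReal {lam : ℝ} (hlam : lam ∈ Set.Icc (0 : ℝ) 1) :
    ENNReal.ofReal (1 - lam) + ENNReal.ofReal lam = 1 := by
  rw [← ENNReal.ofReal_add (sub_nonneg.2 hlam.2) hlam.1]; simp

theorem sMean_bot (lam : ℝ) (a b : ℝ≥0∞) : sMean ⊥ lam a b = min a b := by simp [sMean]

theorem sMean_top (lam : ℝ) (a b : ℝ≥0∞) : sMean ⊤ lam a b = max a b := by simp [sMean]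

theorem sMean_zero (lam : ℝ) (a b : ℝ≥0∞) :
    sMean 0 lam a b = a ^ (1 - lam) * b ^ lam := by simp [sMean]

theorem sMean_coe {s : ℝ} (hs : s ≠ 0) (lam : ℝ) (a b : ℝ≥0∞) :
    sMean (s : EReal) lam a b =
      (ENNReal.ofReal (1 - lam) * a ^ s + ENNReal.ofReal lam * b ^ s) ^ (1 / s) := by
  simp [sMean, hs]

/-- Case distinction for the exponent of a mean. -/
theorem EReal.cases_zero {P : EReal → Prop} (hbot : P ⊥) (htop : P ⊤) (h0 : P 0)
    (hcoe : ∀ s : ℝ, s ≠ 0 → P s) (s : EReal) : P s := by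
  induction s with
  | bot => exact hbot
  | top => exact htop
  | coe s =>
    rcases eq_or_ne s 0 with rfl | hs
    · exact h0
    · exact hcoe s hs

theorem sMean_swap (s : EReal) (lam : ℝ) (a b : ℝ≥0∞) :
    sMean s lam a b = sMean s (1 - lam) b a := by
  induction s using EReal.cases_zero with
  | hbot => simp [sMean_bot, min_comm]
  | htop => simp [sMean_top, max_comm]
  | h0 => simp [sMean_zero, mul_comm]
  | hcoe s hs => simp [sMean_coe hs, add_comm]

theorem sMean_mono (s : EReal) {lam : ℝ} (hlam : lam ∈ Set.Icc (0 : ℝ) 1) {a a' b b' : ℝ≥0∞}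
    (ha : a ≤ a') (hb : b ≤ b') : sMean s lam a b ≤ sMean s lam a' b' := by
  induction s using EReal.cases_zero with
  | hbot => rw [sMean_bot, sMean_bot]; exact min_le_min ha hb
  | htop => rw [sMean_top, sMean_top]; exact max_le_max ha hb
  | h0 =>
    rw [sMean_zero, sMean_zero]
    exact mul_le_mul' (ENNReal.rpow_le_rpow ha (sub_nonneg.2 hlam.2))
      (ENNReal.rpow_le_rpow hb hlam.1)
  | hcoe s hs =>
    rw [sMean_coe hs, sMean_coe hs]
    rcases hs.lt_or_gt with hs | hs
    · refine ENNReal.rpow_le_rpow_of_nonpos_exponent ?_ (one_div_neg.2 hs).le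
      gcongr ?_ * ?_ + ?_ * ?_
      · exact le_rfl
      · exact ENNReal.rpow_le_rpow_of_nonpos_exponent ha hs.le
      · exact le_rfl
      · exact ENNReal.rpow_le_rpow_of_nonpos_exponent hb hs.le
    · refine ENNReal.rpow_le_rpow ?_ (one_div_pos.2 hs).le
      gcongr

theorem sMean_self (s : EReal) {lam : ℝ} (hlam : lam ∈ Set.Icc (0 : ℝ) 1) (a : ℝ≥0∞) :
    sMean s lam a a = a := by
  induction s using EReal.cases_zero with
  | hbot => simp [sMean_bot]
  | htop => simp [sMean_top]
  | h0 =>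
    rw [sMean_zero, ← ENNReal.rpow_add_of_nonneg _ _ (sub_nonneg.2 hlam.2) hlam.1]
    simp
  | hcoe s hs =>
    rw [sMean_coe hs, ← add_mul, ENNReal.ofReal_one_sub_add_ofReal hlam, one_mul,
      ← ENNReal.rpow_mul, mul_one_div_cancel hs, ENNReal.rpow_one]

theorem min_le_sMean (s : EReal) {lam : ℝ} (hlam : lam ∈ Set.Icc (0 : ℝ) 1) (a b : ℝ≥0∞) :
    min a b ≤ sMean s lam a b :=
  (sMean_self s hlam _).symm.le.trans (sMean_mono s hlam (min_le_left _ _) (min_le_right _ _))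

theorem sMean_le_max (s : EReal) {lam : ℝ} (hlam : lam ∈ Set.Icc (0 : ℝ) 1) (a b : ℝ≥0∞) :
    sMean s lam a b ≤ max a b :=
  (sMean_mono s hlam (le_max_left _ _) (le_max_right _ _)).trans (sMean_self s hlam _).le

theorem sMean_ne_zero (s : EReal) {lam : ℝ} (hlam : lam ∈ Set.Icc (0 : ℝ) 1) {a b : ℝ≥0∞}
    (ha : a ≠ 0) (hb : b ≠ 0) : sMean s lam a b ≠ 0 :=
  ((lt_min ha.bot_lt hb.bot_lt).trans_le (min_le_sMean s hlam a b)).ne'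

theorem sMean_ne_top (s : EReal) {lam : ℝ} (hlam : lam ∈ Set.Icc (0 : ℝ) 1) {a b : ℝ≥0∞}
    (ha : a ≠ ⊤) (hb : b ≠ ⊤) : sMean s lam a b ≠ ⊤ :=
  ((sMean_le_max s hlam a b).trans_lt (max_lt ha.lt_top hb.lt_top)).ne

theorem ENNReal.mul_rpow_of_ne_zero_of_ne_top {c : ℝ≥0∞} (hc : c ≠ 0) (hc' : c ≠ ⊤) (x : ℝ≥0∞)
    (z : ℝ) : (c * x) ^ z = c ^ z * x ^ z := by
  rcases eq_or_ne x ⊤ with rfl | hx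
  · exact ENNReal.mul_rpow_of_ne_zero hc ENNReal.top_ne_zero z
  · exact ENNReal.mul_rpow_of_ne_top hc' hx z

theorem sMean_mul (s : EReal) {lam : ℝ} (hlam : lam ∈ Set.Icc (0 : ℝ) 1) {c : ℝ≥0∞}
    (hc : c ≠ 0) (hc' : c ≠ ⊤) (a b : ℝ≥0∞) :
    sMean s lam (c * a) (c * b) = c * sMean s lam a b := by
  induction s using EReal.cases_zero with
  | hbot => simp only [sMean_bot]; exact (mul_min_of_nonneg _ _ zero_le).symm
  | htop => simp only [sMean_top]; exact (mul_max_of_nonneg _ _ zero_le).symm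
  | h0 =>
    simp only [sMean_zero, ENNReal.mul_rpow_of_ne_zero_of_ne_top hc hc']
    have : c ^ (1 - lam) * c ^ lam = c := by
      rw [← ENNReal.rpow_add_of_nonneg _ _ (sub_nonneg.2 hlam.2) hlam.1]; simp
    rw [mul_mul_mul_comm, this]
  | hcoe s hs =>
    simp only [sMean_coe hs, ENNReal.mul_rpow_of_ne_zero_of_ne_top hc hc']
    rw [mul_left_comm, mul_left_comm (ENNReal.ofReal lam), ← mul_add,
      ENNReal.mul_rpow_of_ne_zero_of_ne_top
        (by simp [ENNReal.rpow_eq_zero_iff, hc, hc']) (by simp [ENNReal.rpow_eq_top_iff, hc, hc']),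
      ← ENNReal.rpow_mul, mul_one_div_cancel hs, ENNReal.rpow_one]

/-- Nonzero limits exclude the form `0 * ∞` in the geometric mean, the only obstruction to
continuity here. -/
theorem tendsto_sMean (s : EReal) (lam : ℝ) {ι : Type*} {l : Filter ι} {u v : ι → ℝ≥0∞}
    {a b : ℝ≥0∞} (ha : a ≠ 0) (hb : b ≠ 0) (hlam : lam ∈ Set.Icc (0 : ℝ) 1)
    (hu : Filter.Tendsto u l (nhds a)) (hv : Filter.Tendsto v l (nhds b)) :
    Filter.Tendsto (fun i => sMean s lam (u i) (v i)) l (nhds (sMean s lam a b)) := by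
  induction s using EReal.cases_zero with
  | hbot => simp only [sMean_bot]; exact hu.min hv
  | htop => simp only [sMean_top]; exact hu.max hv
  | h0 =>
    simp only [sMean_zero]
    refine ENNReal.Tendsto.mul ((ENNReal.continuous_rpow_const.tendsto a).comp hu) (Or.inl ?_)
      ((ENNReal.continuous_rpow_const.tendsto b).comp hv) (Or.inl ?_)
    · simp [ENNReal.rpow_eq_zero_iff, ha, hlam.2]
    · simp [ENNReal.rpow_eq_zero_iff, hb, hlam.1]
  | hcoe s hs =>
    simp only [sMean_coe hs]
    refine (ENNReal.continuous_rpow_const.tendsto _).comp (Filter.Tendsto.add ?_ ?_)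
    · exact ENNReal.Tendsto.const_mul ((ENNReal.continuous_rpow_const.tendsto a).comp hu)
        (Or.inr ENNReal.ofReal_ne_top)
    · exact ENNReal.Tendsto.const_mul ((ENNReal.continuous_rpow_const.tendsto b).comp hv)
        (Or.inr ENNReal.ofReal_ne_top)

/-! ### Hölder's inequality for means. -/

/-- Hölder's inequality for two points with weights. -/
theorem ENNReal.weighted_holder_two (w₁ w₂ x₁ x₂ y₁ y₂ : ℝ≥0∞) {p q : ℝ} (hp : 0 ≤ p)
    (hq : 0 ≤ q) (hpq : p + q = 1) :
    w₁ * (x₁ ^ p * y₁ ^ q) + w₂ * (x₂ ^ p * y₂ ^ q) ≤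
      (w₁ * x₁ + w₂ * x₂) ^ p * (w₁ * y₁ + w₂ * y₂) ^ q := by
  have := ENNReal.lintegral_mul_norm_pow_le (μ := w₁ • Measure.dirac true + w₂ • Measure.dirac false)
    (f := fun i => bif i then x₁ else x₂) (g := fun i => bif i then y₁ else y₂)
    (Measurable.of_discrete).aemeasurable (Measurable.of_discrete).aemeasurable hp hq hpq
  simpa [lintegral_add_measure, lintegral_smul_measure] using this

theorem bblExponent_one_coe {γ : ℝ} (hγ : 1 + γ ≠ 0) :
    bblExponent 1 γ = ((γ / (1 + γ) : ℝ) : EReal) := by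
  simp [bblExponent, hγ]

/-- Hölder's inequality for means: the mean of products with exponent `γ / (1 + γ)` is at most the
product of the mean with exponent `γ` and the arithmetic mean. -/
theorem sMean_mul_le_of_ne_top {γ : EReal} (hγ : ((-1 : ℝ) : EReal) ≤ γ) {lam : ℝ}
    (hlam : lam ∈ Set.Icc (0 : ℝ) 1) {A B u v : ℝ≥0∞} (hA : A ≠ 0) (hA' : A ≠ ⊤) (hB : B ≠ 0)
    (hB' : B ≠ ⊤) (hu : u ≠ 0) (hu' : u ≠ ⊤) (hv : v ≠ 0) (hv' : v ≠ ⊤) :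
    sMean (bblExponent 1 γ) lam (A * u) (B * v) ≤
      sMean γ lam A B * (ENNReal.ofReal (1 - lam) * u + ENNReal.ofReal lam * v) := by
  have arith : ∀ x y, sMean 1 lam x y = ENNReal.ofReal (1 - lam) * x + ENNReal.ofReal lam * y := by
    intro x y
    simpa using sMean_coe one_ne_zero lam x y
  induction γ with
  | bot => exact absurd hγ (EReal.bot_lt_coe _).not_ge
  | top =>
    have : bblExponent 1 ⊤ = 1 := by simp [bblExponent]
    rw [this, ← arith, sMean_top, ← sMean_mul _ hlam (by simp [hA]) (by simp [hA', hB'])]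
    exact sMean_mono _ hlam (by gcongr; exact le_max_left _ _) (by gcongr; exact le_max_right _ _)
  | coe γ =>
    have hγ : -1 ≤ γ := EReal.coe_le_coe_iff.1 hγ
    rcases hγ.eq_or_lt with rfl | hγ
    · have : bblExponent 1 ((-1 : ℝ) : EReal) = ⊥ := by simp [bblExponent]
      rw [this, sMean_bot, sMean_coe (by norm_num)]
      -- `M_{-1}` is the inverse of a sum, so it is cleared to the left; the bounds are then
      -- termwise, `min (A * u) (B * v) * A⁻¹ ≤ u` and likewise for `v`.
      have key : min (A * u) (B * v) *
          (ENNReal.ofReal (1 - lam) * A⁻¹ + ENNReal.ofReal lam * B⁻¹) ≤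
          ENNReal.ofReal (1 - lam) * u + ENNReal.ofReal lam * v := by
        rw [mul_add, mul_left_comm, mul_left_comm _ (ENNReal.ofReal lam)]
        gcongr
        · rw [← div_eq_mul_inv]
          exact ENNReal.div_le_of_le_mul' (min_le_left _ _)
        · rw [← div_eq_mul_inv]
          exact ENNReal.div_le_of_le_mul' (min_le_right _ _)
      have hne : ENNReal.ofReal (1 - lam) * A⁻¹ + ENNReal.ofReal lam * B⁻¹ ≠ 0 := by
        rw [← arith]
        exact sMean_ne_zero _ hlam (by simp [hA']) (by simp [hB'])
      have hnt : ENNReal.ofReal (1 - lam) * A⁻¹ + ENNReal.ofReal lam * B⁻¹ ≠ ⊤ := by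
        rw [← arith]
        exact sMean_ne_top _ hlam (by simp [hA]) (by simp [hB])
      have h1 : (1 / (-1) : ℝ) = -1 := by norm_num
      simp only [h1, ENNReal.rpow_neg_one]
      rw [mul_comm (_⁻¹), ← div_eq_mul_inv]
      exact (ENNReal.le_div_iff_mul_le (Or.inl hne) (Or.inl hnt)).2 key
    have h1γ : 0 < 1 + γ := by linarith
    rw [bblExponent_one_coe h1γ.ne']
    have hAu : A * u ≠ 0 := mul_ne_zero hA hu
    have hAu' : A * u ≠ ⊤ := ENNReal.mul_ne_top hA' hu'
    have hBv : B * v ≠ 0 := mul_ne_zero hB hv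
    have hBv' : B * v ≠ ⊤ := ENNReal.mul_ne_top hB' hv'
    rcases eq_or_ne γ 0 with rfl | hγ0
    · simp only [add_zero, div_one, EReal.coe_zero, sMean_zero]
      rw [ENNReal.mul_rpow_of_ne_top hA' hu', ENNReal.mul_rpow_of_ne_top hB' hv',
        mul_mul_mul_comm]
      gcongr
      rw [← arith]
      lift u to ℝ≥0 using hu'
      lift v to ℝ≥0 using hv'
      have hu : u ≠ 0 := by simpa using hu
      have hv : v ≠ 0 := by simpa using hv
      have := NNReal.geom_mean_le_arith_mean2_weighted ⟨1 - lam, sub_nonneg.2 hlam.2⟩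
        ⟨lam, hlam.1⟩ u v (NNReal.eq (sub_add_cancel 1 lam))
      rw [arith, ENNReal.ofReal_eq_coe_nnreal (sub_nonneg.2 hlam.2),
        ENNReal.ofReal_eq_coe_nnreal hlam.1, ← ENNReal.coe_rpow_of_ne_zero hu,
        ← ENNReal.coe_rpow_of_ne_zero hv]
      exact_mod_cast this
    have hs0 : γ / (1 + γ) ≠ 0 := div_ne_zero hγ0 h1γ.ne'
    have pne : ∀ {x : ℝ≥0∞} (z : ℝ), x ≠ 0 → x ≠ ⊤ → x ^ z ≠ 0 := fun z h h' => by
      simp [ENNReal.rpow_eq_zero_iff, h, h']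
    have pnt : ∀ {x : ℝ≥0∞} (z : ℝ), x ≠ 0 → x ≠ ⊤ → x ^ z ≠ ⊤ := fun z h h' => by
      simp [ENNReal.rpow_eq_top_iff, h, h']
    rw [sMean_coe hs0, sMean_coe hγ0]
    set s := γ / (1 + γ) with hs
    have hU0 : ENNReal.ofReal (1 - lam) * u + ENNReal.ofReal lam * v ≠ 0 := by
      rw [← arith]; exact sMean_ne_zero _ hlam hu hv
    have hUt : ENNReal.ofReal (1 - lam) * u + ENNReal.ofReal lam * v ≠ ⊤ := by
      rw [← arith]; exact sMean_ne_top _ hlam hu' hv'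
    have hS0 : ENNReal.ofReal (1 - lam) * (A * u) ^ s + ENNReal.ofReal lam * (B * v) ^ s ≠ 0 := by
      rw [← arith]; exact sMean_ne_zero _ hlam (pne _ hAu hAu') (pne _ hBv hBv')
    have hSt : ENNReal.ofReal (1 - lam) * (A * u) ^ s + ENNReal.ofReal lam * (B * v) ^ s ≠ ⊤ := by
      rw [← arith]; exact sMean_ne_top _ hlam (pnt _ hAu hAu') (pnt _ hBv hBv')
    rcases hγ0.lt_or_gt with hneg | hpos
    -- For `-1 < γ < 0`, Hölder is applied to `A^γ = ((Au)^s)^(1+γ) * u^(-γ)`; the negative power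
    -- `1/γ` then reverses the inequality.
    · have hol := ENNReal.weighted_holder_two (ENNReal.ofReal (1 - lam)) (ENNReal.ofReal lam)
        ((A * u) ^ s) ((B * v) ^ s) u v (p := 1 + γ) (q := -γ) h1γ.le (by linarith) (by ring)
      have hsγ : s * (1 + γ) = γ := div_mul_cancel₀ _ h1γ.ne'
      have e : ∀ {x y : ℝ≥0∞}, x ≠ ⊤ → y ≠ 0 → y ≠ ⊤ →
          ((x * y) ^ s) ^ (1 + γ) * y ^ (-γ) = x ^ γ := by
        intro x y hx hy hy'
        rw [← ENNReal.rpow_mul, hsγ, ENNReal.mul_rpow_of_ne_top hx hy', mul_assoc,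
          ← ENNReal.rpow_add _ _ hy hy']
        simp
      rw [e hA' hu hu', e hB' hv hv'] at hol
      have := ENNReal.rpow_le_rpow_of_nonpos_exponent hol (one_div_neg.2 hneg).le
      rw [ENNReal.mul_rpow_of_ne_zero (pne _ hS0 hSt) (pne _ hU0 hUt), ← ENNReal.rpow_mul,
        ← ENNReal.rpow_mul] at this
      have e1 : (1 + γ) * (1 / γ) = 1 / s := by rw [hs]; field_simp
      have e2 : -γ * (1 / γ) = -1 := by field_simp
      rw [e1, e2, ENNReal.rpow_neg_one, ← div_eq_mul_inv] at this
      exact (ENNReal.div_le_iff hU0 hUt).1 this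
    · have hspos : 0 < s := div_pos hpos h1γ
      -- For `γ > 0` the splitting is `(Au)^s = (A^γ)^(1/(1+γ)) * u^s`.
      have hol := ENNReal.weighted_holder_two (ENNReal.ofReal (1 - lam)) (ENNReal.ofReal lam)
        (A ^ γ) (B ^ γ) u v (p := 1 / (1 + γ)) (q := s) (by positivity) hspos.le
        (by rw [hs]; field_simp)
      have e : ∀ {x y : ℝ≥0∞}, (x ^ γ) ^ (1 / (1 + γ)) * y ^ s = (x * y) ^ s := by
        intro x y
        rw [← ENNReal.rpow_mul, ENNReal.mul_rpow_of_nonneg _ _ hspos.le, hs, mul_one_div]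
      rw [e, e] at hol
      have := ENNReal.rpow_le_rpow hol (one_div_pos.2 hspos).le
      rw [ENNReal.mul_rpow_of_nonneg _ _ (one_div_pos.2 hspos).le, ← ENNReal.rpow_mul,
        ← ENNReal.rpow_mul, mul_one_div_cancel hspos.ne', ENNReal.rpow_one] at this
      have e1 : 1 / (1 + γ) * (1 / s) = 1 / γ := by rw [hs]; field_simp
      rwa [e1] at this

/-- Infinite `u` or `v` is harmless: both weights are positive, so the right side is then infinite.
-/
theorem sMean_mul_le {γ : EReal} (hγ : ((-1 : ℝ) : EReal) ≤ γ) {lam : ℝ}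
    (hlam : lam ∈ Set.Ioo (0 : ℝ) 1) {A B u v : ℝ≥0∞} (hA : A ≠ 0) (hA' : A ≠ ⊤) (hB : B ≠ 0)
    (hB' : B ≠ ⊤) (hu : u ≠ 0) (hv : v ≠ 0) :
    sMean (bblExponent 1 γ) lam (A * u) (B * v) ≤
      sMean γ lam A B * (ENNReal.ofReal (1 - lam) * u + ENNReal.ofReal lam * v) := by
  have hlam' := Set.Ioo_subset_Icc_self hlam
  have hM := sMean_ne_zero γ hlam' hA hB
  rcases eq_or_ne u ⊤ with rfl | hu'
  · simp [ENNReal.mul_top, hlam.2, hM]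
  rcases eq_or_ne v ⊤ with rfl | hv'
  · simp [ENNReal.mul_top, hlam.1, hM]
  exact sMean_mul_le_of_ne_top hγ hlam' hA hA' hB hB' hu hu' hv hv'

/-! ### Brunn–Minkowski on the line and superlevel sets. -/

/-- The one-dimensional Brunn–Minkowski inequality for compact sets. -/
theorem Real.volume_add_volume_le_of_isCompact {K L C : Set ℝ} (hK : IsCompact K)
    (hL : IsCompact L) (hK0 : K.Nonempty) (hL0 : L.Nonempty)
    (hC : ∀ a ∈ K, ∀ b ∈ L, a + b ∈ C) : volume K + volume L ≤ volume C := by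
  -- The translates `K + min L` and `max K + L` both lie in `C` and meet only at `max K + min L`.
  obtain ⟨a, ha, hmax⟩ := hK.exists_isGreatest hK0
  obtain ⟨b, hb, hmin⟩ := hL.exists_isLeast hL0
  have h1 : volume ((fun x => x + b) '' K) = volume K := by
    simp [Set.image_add_right]
  have h2 : volume ((fun x => a + x) '' L) = volume L := by
    simp [Set.image_add_left]
  have hd : AEDisjoint volume ((fun x => x + b) '' K) ((fun x => a + x) '' L) := by
    refine measure_mono_null (t := {a + b}) ?_ (by simp)
    rintro _ ⟨⟨x, hx, rfl⟩, ⟨y, hy, hxy⟩⟩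
    have := hmax hx
    have := hmin hy
    simp only [Set.mem_singleton_iff] at hxy ⊢
    linarith
  rw [← h1, ← h2, ← measure_union₀ _ hd]
  · refine measure_mono (Set.union_subset ?_ ?_)
    · rintro _ ⟨x, hx, rfl⟩; exact hC x hx b hb
    · rintro _ ⟨x, hx, rfl⟩; exact hC a ha x hx
  · exact (hL.image (by fun_prop)).measurableSet.nullMeasurableSet

/-- The one-dimensional Brunn–Minkowski inequality. -/
theorem Real.volume_add_volume_le {A B C : Set ℝ} (hA : MeasurableSet A) (hB : MeasurableSet B)
    (hA0 : A.Nonempty) (hB0 : B.Nonempty) (hC : ∀ a ∈ A, ∀ b ∈ B, a + b ∈ C) :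
    volume A + volume B ≤ volume C := by
  obtain ⟨a, ha⟩ := hA0
  obtain ⟨b, hb⟩ := hB0
  rw [hA.measure_eq_iSup_isCompact, hB.measure_eq_iSup_isCompact]
  simp only [iSup_and']
  refine ENNReal.biSup_add_biSup_le' ⟨∅, by simp⟩ ⟨∅, by simp⟩ ?_
  rintro K ⟨hKA, hK⟩ L ⟨hLB, hL⟩
  -- The approximating compact sets may be empty; inserting a point of `A` and of `B` repairs this.
  calc volume K + volume L ≤ volume (insert a K) + volume (insert b L) := by
        gcongr <;> exact Set.subset_insert _ _
    _ ≤ volume C := Real.volume_add_volume_le_of_isCompact (hK.insert a) (hL.insert b)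
        (Set.insert_nonempty _ _) (Set.insert_nonempty _ _) fun x hx y hy =>
          hC x (Set.insert_subset ha hKA hx) y (Set.insert_subset hb hLB hy)

theorem Real.weighted_volume_add_volume_le {A B C : Set ℝ} (hA : MeasurableSet A)
    (hB : MeasurableSet B) (hA0 : A.Nonempty) (hB0 : B.Nonempty) {p q : ℝ} (hp : 0 < p)
    (hq : 0 < q) (hC : ∀ a ∈ A, ∀ b ∈ B, p * a + q * b ∈ C) :
    ENNReal.ofReal p * volume A + ENNReal.ofReal q * volume B ≤ volume C := by
  have := Real.volume_add_volume_le (C := C) (hA.const_smul₀ p) (hB.const_smul₀ q) hA0.smul_set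
    hB0.smul_set (by rintro _ ⟨a, ha, rfl⟩ _ ⟨b, hb, rfl⟩; exact hC a ha b hb)
  simpa [Measure.addHaar_smul, abs_of_pos hp, abs_of_pos hq] using this

theorem lintegral_eq_lintegral_measure_lt {α : Type*} [MeasurableSpace α] (μ : Measure α)
    {f : α → ℝ≥0∞} (hf : Measurable f) (hf' : ∀ x, f x ≠ ⊤) :
    ∫⁻ x, f x ∂μ = ∫⁻ t in Set.Ioi (0 : ℝ), μ {x | ENNReal.ofReal t < f x} := by
  have := lintegral_eq_lintegral_meas_lt μ (f := fun x => (f x).toReal)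
    (Filter.Eventually.of_forall fun x => ENNReal.toReal_nonneg) hf.ennreal_toReal.aemeasurable
  simp only [ENNReal.ofReal_toReal (hf' _)] at this
  rw [this]
  refine setLIntegral_congr_fun measurableSet_Ioi fun t ht => ?_
  simp only [ENNReal.ofReal_lt_iff_lt_toReal (le_of_lt ht) (hf' _)]

/-- If `f` and `g` have supremum `1` and `h` at a weighted mean of two points is at least the
minimum of the values of `f` and `g`, then the integral of `h` is at least the weighted mean of
the integrals of `f` and `g`. -/
theorem lintegral_add_lintegral_le_of_min_le {f g h : ℝ → ℝ≥0∞} (hf : Measurable f)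
    (hg : Measurable g) (hh : Measurable h) (hf1 : ⨆ x, f x = 1) (hg1 : ⨆ x, g x = 1)
    {p q : ℝ} (hp : 0 < p) (hq : 0 < q) (H : ∀ x y, min (f x) (g y) ≤ h (p * x + q * y)) :
    ENNReal.ofReal p * (∫⁻ x, f x) + ENNReal.ofReal q * (∫⁻ x, g x) ≤ ∫⁻ x, h x := by
  have hfle : ∀ x, f x ≤ 1 := fun x => hf1 ▸ le_iSup f x
  have hgle : ∀ x, g x ≤ 1 := fun x => hg1 ▸ le_iSup g x
  -- Capping `h` at `1` makes it finite for the layer-cake formula and loses nothing, since only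
  -- levels below `1` matter.
  have hlt : ∫⁻ x, min (h x) 1 ≤ ∫⁻ x, h x := lintegral_mono fun x => min_le_left _ _
  refine le_trans ?_ hlt
  rw [lintegral_eq_lintegral_measure_lt volume hf fun x => ((hfle x).trans_lt (by simp)).ne,
    lintegral_eq_lintegral_measure_lt volume hg fun x => ((hgle x).trans_lt (by simp)).ne,
    lintegral_eq_lintegral_measure_lt volume (hh.min measurable_const)
      fun x => ((min_le_right _ _).trans_lt (by simp)).ne]
  refine (add_le_add (lintegral_const_mul_le _ _) (lintegral_const_mul_le _ _)).trans
    ((le_lintegral_add _ _).trans (setLIntegral_mono' measurableSet_Ioi fun t ht => ?_))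
  rcases lt_or_ge (ENNReal.ofReal t) 1 with ht1 | ht1
  · obtain ⟨x, hx⟩ := lt_iSup_iff.1 (ht1.trans_eq hf1.symm)
    obtain ⟨y, hy⟩ := lt_iSup_iff.1 (ht1.trans_eq hg1.symm)
    refine Real.weighted_volume_add_volume_le (measurableSet_lt measurable_const hf)
      (measurableSet_lt measurable_const hg) ⟨x, hx⟩ ⟨y, hy⟩ hp hq fun a ha b hb => ?_
    exact lt_min ((lt_min ha hb).trans_le (H a b)) ht1
  · have e1 : {x | ENNReal.ofReal t < f x} = ∅ :=
      Set.eq_empty_of_forall_notMem fun x hx => (hx.trans_le ((hfle x).trans ht1)).false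
    have e2 : {x | ENNReal.ofReal t < g x} = ∅ :=
      Set.eq_empty_of_forall_notMem fun x hx => (hx.trans_le ((hgle x).trans ht1)).false
    simp [e1, e2]

/-! ### The one-dimensional inequality. -/

/-- The Borell–Brascamp–Lieb inequality on the measure space `E`, with exponent `γ` for functions
and exponent `s` for integrals, for measurable functions with nonzero integrals. -/
def BorellBrascampLieb (E : Type*) [AddCommGroup E] [Module ℝ E] [MeasureSpace E] (lam : ℝ)
    (γ s : EReal) : Prop :=
  ∀ f g h : E → ℝ≥0∞, Measurable f → Measurable g → Measurable h →
    (∀ x y, f x ≠ 0 → g y ≠ 0 → sMean γ lam (f x) (g y) ≤ h ((1 - lam) • x + lam • y)) →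
    ∫⁻ x, f x ≠ 0 → ∫⁻ x, g x ≠ 0 →
    sMean s lam (∫⁻ x, f x) (∫⁻ x, g x) ≤ ∫⁻ x, h x

theorem iSup_ne_zero_of_lintegral_ne_zero {α : Type*} [MeasurableSpace α] {μ : Measure α}
    {f : α → ℝ≥0∞} (hf : ∫⁻ x, f x ∂μ ≠ 0) : ⨆ x, f x ≠ 0 := by
  contrapose! hf
  have : ∀ x, f x = 0 := by simpa using hf
  simp [this]

theorem sMean_lintegral_le_of_bounded {γ : EReal} (hγ : ((-1 : ℝ) : EReal) ≤ γ) {lam : ℝ}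
    (hlam : lam ∈ Set.Ioo (0 : ℝ) 1) {f g h : ℝ → ℝ≥0∞} (hf : Measurable f) (hg : Measurable g)
    (hh : Measurable h)
    (H : ∀ x y, f x ≠ 0 → g y ≠ 0 → sMean γ lam (f x) (g y) ≤ h ((1 - lam) • x + lam • y))
    (hf0 : ∫⁻ x, f x ≠ 0) (hg0 : ∫⁻ x, g x ≠ 0) (hf1 : ⨆ x, f x ≠ ⊤) (hg1 : ⨆ x, g x ≠ ⊤) :
    sMean (bblExponent 1 γ) lam (∫⁻ x, f x) (∫⁻ x, g x) ≤ ∫⁻ x, h x := by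
  have hlam' := Set.Ioo_subset_Icc_self hlam
  have hA0 := iSup_ne_zero_of_lintegral_ne_zero hf0
  have hB0 := iSup_ne_zero_of_lintegral_ne_zero hg0
  set A := ⨆ x, f x with hA
  set B := ⨆ x, g x with hB
  have hM0 := sMean_ne_zero γ hlam' hA0 hB0
  have hMt := sMean_ne_top γ hlam' hf1 hg1
  have key := lintegral_add_lintegral_le_of_min_le (f := fun x => A⁻¹ * f x)
    (g := fun x => B⁻¹ * g x) (h := fun x => (sMean γ lam A B)⁻¹ * h x) (hf.const_mul _)
    (hg.const_mul _) (hh.const_mul _)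
    (by rw [← ENNReal.mul_iSup, ← hA, ENNReal.inv_mul_cancel hA0 hf1])
    (by rw [← ENNReal.mul_iSup, ← hB, ENNReal.inv_mul_cancel hB0 hg1])
    (sub_pos.2 hlam.2) hlam.1 ?_
  · rw [lintegral_const_mul _ hf, lintegral_const_mul _ hg, lintegral_const_mul _ hh] at key
    have hol := sMean_mul_le hγ hlam hA0 hf1 hB0 hg1 (u := A⁻¹ * ∫⁻ x, f x)
      (v := B⁻¹ * ∫⁻ x, g x) (mul_ne_zero (by simpa using hf1) hf0)
      (mul_ne_zero (by simpa using hg1) hg0)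
    rw [ENNReal.mul_inv_cancel_left hA0 hf1, ENNReal.mul_inv_cancel_left hB0 hg1] at hol
    refine hol.trans ((mul_le_mul_right key _).trans ?_)
    rw [ENNReal.mul_inv_cancel_left hM0 hMt]
  · intro x y
    rcases eq_or_ne (f x) 0 with hx | hx
    · simp [hx]
    rcases eq_or_ne (g y) 0 with hy | hy
    · simp [hy]
    have hAi : A⁻¹ ≠ 0 := by simpa using hf1
    have hBi : B⁻¹ ≠ 0 := by simpa using hg1
    have hfx : f x ≠ ⊤ := ((le_iSup f x).trans_lt hf1.lt_top).ne
    -- At the common level `m` one has `m * A ≤ f x` and `m * B ≤ g y`, so homogeneity gives `m *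
    -- M_γ(A, B) ≤ h`.
    set m := min (A⁻¹ * f x) (B⁻¹ * g y)
    have hm0 : m ≠ 0 := (lt_min (mul_ne_zero hAi hx).bot_lt (mul_ne_zero hBi hy).bot_lt).ne'
    have hmt : m ≠ ⊤ :=
      ((min_le_left _ _).trans_lt (ENNReal.mul_lt_top (by simp [pos_iff_ne_zero, hA0]) hfx.lt_top)).ne
    rw [← ENNReal.div_eq_inv_mul, ENNReal.le_div_iff_mul_le (Or.inl hM0) (Or.inl hMt),
      ← sMean_mul γ hlam' hm0 hmt]
    refine (sMean_mono γ hlam' ?_ ?_).trans (H x y hx hy)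
    · calc m * A ≤ (A⁻¹ * f x) * A := by gcongr; exact min_le_left _ _
        _ = f x := by rw [mul_comm, ENNReal.mul_inv_cancel_left hA0 hf1]
    · calc m * B ≤ (B⁻¹ * g y) * B := by gcongr; exact min_le_right _ _
        _ = g y := by rw [mul_comm, ENNReal.mul_inv_cancel_left hB0 hg1]

theorem tendsto_lintegral_min_natCast {α : Type*} [MeasurableSpace α] {μ : Measure α}
    {f : α → ℝ≥0∞} (hf : Measurable f) :
    Filter.Tendsto (fun k : ℕ => ∫⁻ x, min (f x) k ∂μ) Filter.atTop (nhds (∫⁻ x, f x ∂μ)) := by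
  refine lintegral_tendsto_of_tendsto_of_monotone
    (fun k => (hf.min measurable_const).aemeasurable) (Filter.Eventually.of_forall fun x => ?_)
    (Filter.Eventually.of_forall fun x => ?_)
  · intro k l hkl
    exact min_le_min le_rfl (by exact_mod_cast hkl)
  · simpa using (tendsto_const_nhds (x := f x)).min ENNReal.tendsto_nat_nhds_top

theorem borellBrascampLieb_real {γ : EReal} (hγ : ((-1 : ℝ) : EReal) ≤ γ) {lam : ℝ}
    (hlam : lam ∈ Set.Ioo (0 : ℝ) 1) : BorellBrascampLieb ℝ lam γ (bblExponent 1 γ) := by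
  intro f g h hf hg hh H hf0 hg0
  have hlam' := Set.Ioo_subset_Icc_self hlam
  have tf := tendsto_lintegral_min_natCast (μ := volume) hf
  have tg := tendsto_lintegral_min_natCast (μ := volume) hg
  refine le_of_tendsto (tendsto_sMean _ lam hf0 hg0 hlam' tf tg) ?_
  filter_upwards [tf.eventually_ne hf0, tg.eventually_ne hg0] with k hfk hgk
  refine sMean_lintegral_le_of_bounded hγ hlam (hf.min measurable_const)
    (hg.min measurable_const) hh (fun x y hx hy => ?_) hfk hgk ?_ ?_
  · refine (sMean_mono γ hlam' (min_le_left _ _) (min_le_left _ _)).trans (H x y ?_ ?_)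
    · rintro h0; simp [h0] at hx
    · rintro h0; simp [h0] at hy
  · exact ((iSup_le fun x => min_le_right _ _).trans_lt (ENNReal.natCast_lt_top k)).ne
  · exact ((iSup_le fun x => min_le_right _ _).trans_lt (ENNReal.natCast_lt_top k)).ne

/-! ### Products and induction on the dimension. -/

/-- The conclusion on slices in `F` is needed only where both inner integrals are nonzero, which is
exactly where `hF` applies. -/
theorem BorellBrascampLieb.prod {E F : Type*} [AddCommGroup E] [Module ℝ E] [MeasureSpace E]
    [AddCommGroup F] [Module ℝ F] [MeasureSpace F]
    [SFinite (volume : Measure E)] [SFinite (volume : Measure F)]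
    {lam : ℝ} {γ s t : EReal} (hE : BorellBrascampLieb E lam s t)
    (hF : BorellBrascampLieb F lam γ s) : BorellBrascampLieb (E × F) lam γ t := by
  intro f g h hf hg hh H hf0 hg0
  have fub : ∀ {u : E × F → ℝ≥0∞}, Measurable u → ∫⁻ z, u z = ∫⁻ x, ∫⁻ y, u (x, y) :=
    fun hu => lintegral_prod _ hu.aemeasurable
  rw [fub hf] at hf0 ⊢
  rw [fub hg] at hg0 ⊢
  rw [fub hh]
  refine hE _ _ _ hf.lintegral_prod_right' hg.lintegral_prod_right' hh.lintegral_prod_right'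
    (fun x y hx hy => ?_) hf0 hg0
  refine hF _ _ _ (hf.comp measurable_prodMk_left) (hg.comp measurable_prodMk_left)
    (hh.comp measurable_prodMk_left) (fun x' y' hx' hy' => ?_) hx hy
  exact H (x, x') (y, y') hx' hy'

theorem BorellBrascampLieb.of_measurePreserving {E F : Type*} [AddCommGroup E] [Module ℝ E]
    [MeasureSpace E] [AddCommGroup F] [Module ℝ F] [MeasureSpace F] {lam : ℝ} {γ s : EReal}
    (hE : BorellBrascampLieb E lam γ s) (e : E ≃ᵐ F) (he : MeasurePreserving e)
    (hlin : ∀ x y : E, e ((1 - lam) • x + lam • y) = (1 - lam) • e x + lam • e y) :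
    BorellBrascampLieb F lam γ s := by
  intro f g h hf hg hh H hf0 hg0
  rw [← he.lintegral_comp_emb e.measurableEmbedding] at hf0 hg0 ⊢
  rw [← he.lintegral_comp_emb e.measurableEmbedding, ← he.lintegral_comp_emb e.measurableEmbedding]
  refine hE _ _ _ (hf.comp e.measurable) (hg.comp e.measurable) (hh.comp e.measurable)
    (fun x y hx hy => ?_) hf0 hg0
  rw [hlin]
  exact H _ _ hx hy

theorem bblExponent_succ {n : ℕ} (hn : 1 ≤ n) {γ : EReal}
    (hγ : ((-1 / ((n + 1 : ℕ) : ℝ) : ℝ) : EReal) ≤ γ) :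
    ((-1 : ℝ) : EReal) ≤ bblExponent n γ ∧
      bblExponent 1 (bblExponent n γ) = bblExponent (n + 1) γ := by
  have hn' : (1 : ℝ) ≤ n := by exact_mod_cast hn
  induction γ with
  | bot => exact absurd hγ (EReal.bot_lt_coe _).not_ge
  | top =>
    have h1 : (0 : ℝ) < 1 / n := by positivity
    have e : bblExponent n ⊤ = ((1 / n : ℝ) : EReal) := by simp [bblExponent]
    rw [e, bblExponent_one_coe (by positivity)]
    refine ⟨EReal.coe_le_coe_iff.2 (by linarith), ?_⟩
    simp only [bblExponent, if_true]
    congr 1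
    push_cast
    field_simp
  | coe γ =>
    have hγ : -1 / ((n + 1 : ℕ) : ℝ) ≤ γ := EReal.coe_le_coe_iff.1 hγ
    push_cast at hγ
    rw [div_le_iff₀ (by positivity)] at hγ
    have h1 : 0 < 1 + γ * n := by
      rcases le_or_gt 0 γ with h | h
      · positivity
      · nlinarith
    have e : bblExponent n γ = ((γ / (1 + γ * n) : ℝ) : EReal) := by simp [bblExponent, h1.ne']
    -- The denominator at dimension `n + 1` vanishes exactly when `bblExponent n γ = -1`, so the two
    -- end points match.
    have e2 : 1 + γ / (1 + γ * n) = (1 + γ * (n + 1)) / (1 + γ * n) := by field_simp; ring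
    rw [e]
    refine ⟨EReal.coe_le_coe_iff.2 ?_, ?_⟩
    · rw [le_div_iff₀ h1]; linarith
    · rcases eq_or_ne (1 + γ * (n + 1)) 0 with h0 | h0
      · rw [h0, zero_div] at e2
        simp [bblExponent, e2, h0]
      · have h2 : 1 + γ / (1 + γ * n) ≠ 0 := by rw [e2]; exact div_ne_zero h0 h1.ne'
        rw [bblExponent_one_coe h2, e2]
        simp only [bblExponent, EReal.coe_ne_top, if_false, EReal.toReal_coe]
        push_cast
        rw [if_neg h0]
        congr 1
        field_simp

theorem borellBrascampLieb_pi {lam : ℝ} (hlam : lam ∈ Set.Ioo (0 : ℝ) 1) {n : ℕ} (hn : 1 ≤ n) :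
    ∀ {γ : EReal}, ((-1 / (n : ℝ) : ℝ) : EReal) ≤ γ →
      BorellBrascampLieb (Fin n → ℝ) lam γ (bblExponent n γ) := by
  induction n, hn using Nat.le_induction with
  | base =>
    intro γ hγ
    exact (borellBrascampLieb_real (by simpa using hγ) hlam).of_measurePreserving
      (MeasurableEquiv.funUnique (Fin 1) ℝ).symm
      ((volume_preserving_funUnique (Fin 1) ℝ).symm _) fun x y => by ext; simp
  | succ n hn ih =>
    intro γ hγ
    obtain ⟨h1, h2⟩ := bblExponent_succ hn hγ
    have hle : ((-1 / (n : ℝ) : ℝ) : EReal) ≤ γ := by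
      refine le_trans (EReal.coe_le_coe_iff.2 ?_) hγ
      rw [neg_div, neg_div, neg_le_neg_iff]
      have : (0 : ℝ) < n := by exact_mod_cast hn
      exact one_div_le_one_div_of_le this (by push_cast; linarith)
    rw [← h2]
    refine ((borellBrascampLieb_real h1 hlam).prod (ih hle)).of_measurePreserving
      (MeasurableEquiv.piFinSuccAbove (fun _ => ℝ) 0).symm
      ((volume_preserving_piFinSuccAbove (fun _ => ℝ) 0).symm _) fun x y => ?_
    ext i
    refine Fin.cases ?_ (fun j => ?_) i <;> simp [MeasurableEquiv.piFinSuccAbove]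

/-! ### Degenerate cases: end-point weights and vanishing integrals. -/

theorem sMean_one_of_ne {s : EReal} (h : s ≠ ⊥) (h' : s ≠ ⊤) (a b : ℝ≥0∞) :
    sMean s 1 a b = b := by
  induction s using EReal.cases_zero with
  | hbot => exact absurd rfl h
  | htop => exact absurd rfl h'
  | h0 => simp [sMean_zero]
  | hcoe s hs =>
    rw [sMean_coe hs]
    simp [← ENNReal.rpow_mul, hs]

theorem sMean_one_le {s : EReal} (h : s ≠ ⊤) (a b : ℝ≥0∞) : sMean s 1 a b ≤ b := by
  rcases eq_or_ne s ⊥ with rfl | hs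
  · rw [sMean_bot]; exact min_le_right _ _
  · exact (sMean_one_of_ne hs h a b).le

theorem le_sMean_one {s : EReal} (h : s ≠ ⊥) (a b : ℝ≥0∞) : b ≤ sMean s 1 a b := by
  rcases eq_or_ne s ⊤ with rfl | hs
  · rw [sMean_top]; exact le_max_right _ _
  · exact (sMean_one_of_ne h hs a b).ge

theorem sMean_zero_left_of_nonpos {s : EReal} (hs : s ≤ 0) {lam : ℝ}
    (hlam : lam ∈ Set.Ioo (0 : ℝ) 1) (b : ℝ≥0∞) : sMean s lam 0 b = 0 := by
  induction s using EReal.cases_zero with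
  | hbot => simp [sMean_bot]
  | htop => simp at hs
  | h0 => simp [sMean_zero, ENNReal.zero_rpow_of_pos (sub_pos.2 hlam.2)]
  | hcoe s hs0 =>
    have hs : s < 0 := lt_of_le_of_ne (by exact_mod_cast hs) hs0
    rw [sMean_coe hs0, ENNReal.zero_rpow_of_neg hs, ENNReal.mul_top (by simpa using hlam.2),
      top_add, ENNReal.top_rpow_of_neg (one_div_neg.2 hs)]

theorem sMean_zero_left_of_pos {s : ℝ} (hs : 0 < s) (lam : ℝ) (b : ℝ≥0∞) :
    sMean s lam 0 b = ENNReal.ofReal lam ^ (1 / s) * b := by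
  rw [sMean_coe hs.ne', ENNReal.zero_rpow_of_pos hs, mul_zero, zero_add,
    ENNReal.mul_rpow_of_nonneg _ _ (one_div_pos.2 hs).le, ← ENNReal.rpow_mul,
    mul_one_div_cancel hs.ne', ENNReal.rpow_one]

theorem bblExponent_ne_top (n : ℕ) (γ : EReal) : bblExponent n γ ≠ ⊤ := by
  unfold bblExponent
  split_ifs <;> simp

theorem lintegral_comp_add_smul {n : ℕ} {h : (Fin n → ℝ) → ℝ≥0∞} (hh : Measurable h)
    (v : Fin n → ℝ) {r : ℝ} (hr : 0 < r) :
    ENNReal.ofReal r ^ n * (∫⁻ y, h (v + r • y)) = ∫⁻ y, h y := by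
  have hm : Measurable fun y => h (v + y) := hh.comp (measurable_const_add v)
  rw [← lintegral_map (f := fun y => h (v + y)) hm (measurable_const_smul r),
    Measure.map_addHaar_smul _ hr.ne', lintegral_smul_measure,
    lintegral_add_left_eq_self, Module.finrank_fin_fun, smul_eq_mul, ← mul_assoc,
    ← ENNReal.ofReal_pow hr.le, ← ENNReal.ofReal_mul (by positivity),
    abs_of_pos (by positivity), mul_inv_cancel₀ (by positivity), ENNReal.ofReal_one, one_mul]

/-- If `h` dominates a multiple of `g` composed with a similarity of ratio `r`, its integral
dominates the corresponding multiple of the integral of `g`. -/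
theorem pow_mul_mul_lintegral_le {n : ℕ} {g h : (Fin n → ℝ) → ℝ≥0∞} (hh : Measurable h)
    (v : Fin n → ℝ) {r : ℝ} (hr : 0 < r) {c : ℝ≥0∞} (hc : c ≠ ⊤)
    (H : ∀ y, g y ≠ 0 → c * g y ≤ h (v + r • y)) :
    ENNReal.ofReal r ^ n * (c * ∫⁻ y, g y) ≤ ∫⁻ y, h y := by
  rw [← lintegral_comp_add_smul hh v hr, ← lintegral_const_mul' c g hc]
  gcongr with y
  rcases eq_or_ne (g y) 0 with hy | hy
  · simp [hy]
  · exact H y hy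

/-- One point `x` with `f x ≠ 0` suffices: on the image of `y ↦ (1 - lam) x + lam y`, `h` dominates
a multiple of `g`, and the Jacobian supplies `lam ^ n`. -/
theorem sMean_lintegral_le_of_degenerate {n : ℕ} (hn : 1 ≤ n) {γ : EReal}
    (hγ : ((-1 / (n : ℝ) : ℝ) : EReal) ≤ γ) {lam : ℝ} {f g h : (Fin n → ℝ) → ℝ≥0∞}
    (hh : Measurable h) (hf : ∃ x, f x ≠ 0)
    (H : ∀ x y, f x ≠ 0 → g y ≠ 0 → sMean γ lam (f x) (g y) ≤ h ((1 - lam) • x + lam • y))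
    (hdeg : lam = 1 ∨ lam ∈ Set.Ioo (0 : ℝ) 1 ∧ ∫⁻ x, f x = 0) :
    sMean (bblExponent n γ) lam (∫⁻ x, f x) (∫⁻ x, g x) ≤ ∫⁻ x, h x := by
  obtain ⟨x, hx⟩ := hf
  have hbot : γ ≠ ⊥ := ((EReal.bot_lt_coe _).trans_le hγ).ne'
  have hn' : (1 : ℝ) ≤ n := by exact_mod_cast hn
  rcases hdeg with rfl | ⟨hlam, hf0⟩
  · have := pow_mul_mul_lintegral_le (g := g) hh ((1 - (1 : ℝ)) • x) one_pos ENNReal.one_ne_top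
      fun y hy => (by rw [one_mul]; exact (le_sMean_one hbot _ _).trans (H x y hx hy))
    refine (sMean_one_le (bblExponent_ne_top n γ) _ _).trans ?_
    simpa using this
  rw [hf0]
  have hlam' := Set.Ioo_subset_Icc_self hlam
  -- Replacing `f x` by `0` only lowers the mean. The choices are `c = 1` for `γ = ∞` and `c =
  -- lam^(1/γ)` for `0 < γ < ∞`; in the latter case `lam^n * c = lam^(1/s)`, with `s` the exponent
  -- for integrals.
  have key : ∀ {c : ℝ≥0∞}, c ≠ ⊤ → (∀ b, c * b ≤ sMean γ lam 0 b) →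
      ENNReal.ofReal lam ^ n * (c * ∫⁻ y, g y) ≤ ∫⁻ y, h y := fun hc hcb =>
    pow_mul_mul_lintegral_le hh ((1 - lam) • x) hlam.1 hc fun y hy =>
      (hcb _).trans ((sMean_mono γ hlam' zero_le le_rfl).trans (H x y hx hy))
  induction γ with
  | bot => exact absurd rfl hbot
  | top =>
    have e : bblExponent n ⊤ = ((1 / n : ℝ) : EReal) := by simp [bblExponent]
    rw [e, sMean_zero_left_of_pos (by positivity), one_div_one_div, ENNReal.rpow_natCast]
    simpa using key ENNReal.one_ne_top fun b => by simp [sMean_top]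
  | coe γ =>
    have hγ : -1 / (n : ℝ) ≤ γ := EReal.coe_le_coe_iff.1 hγ
    rw [div_le_iff₀ (by positivity)] at hγ
    rcases le_or_gt γ 0 with hγ0 | hγ0
    · rw [sMean_zero_left_of_nonpos _ hlam]
      · exact zero_le
      rcases eq_or_ne (1 + γ * n) 0 with h0 | h0
      · have e : bblExponent n γ = ⊥ := by simp [bblExponent, h0]
        rw [e]
        exact bot_le
      · have e : bblExponent n γ = ((γ / (1 + γ * n) : ℝ) : EReal) := by simp [bblExponent, h0]
        rw [e]
        exact EReal.coe_nonpos.2 (div_nonpos_of_nonpos_of_nonneg hγ0 (by linarith))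
    · have h1 : 0 < 1 + γ * n := by positivity
      have e : bblExponent n γ = ((γ / (1 + γ * n) : ℝ) : EReal) := by simp [bblExponent, h1.ne']
      have e2 : 1 / (γ / (1 + γ * n)) = n + 1 / γ := by field_simp; ring
      rw [e, sMean_zero_left_of_pos (by positivity), e2,
        ENNReal.rpow_add_of_nonneg _ _ (by positivity) (by positivity), ENNReal.rpow_natCast,
        mul_assoc]
      exact key (ENNReal.rpow_ne_top_of_nonneg (by positivity) ENNReal.ofReal_ne_top)
        fun b => (sMean_zero_left_of_pos hγ0 lam b).ge

/-! ### Reduction to Borel functions and conclusion. -/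

/-- The value `⊤` on a null set makes the majorant hold everywhere, as the pointwise hypothesis on
`h` requires. -/
theorem AEMeasurable.exists_measurable_ge {α : Type*} [MeasurableSpace α] {μ : Measure α}
    {f : α → ℝ≥0∞} (hf : AEMeasurable f μ) :
    ∃ g : α → ℝ≥0∞, Measurable g ∧ f ≤ g ∧ ∫⁻ x, g x ∂μ = ∫⁻ x, f x ∂μ := by
  classical
  obtain ⟨s, hs, hsm, hs0⟩ := exists_measurable_superset_of_null hf.ae_eq_mk
  refine ⟨fun x => if x ∈ s then ⊤ else hf.mk f x,
    Measurable.ite hsm measurable_const hf.measurable_mk, fun x => ?_, lintegral_congr_ae ?_⟩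
  · by_cases hx : x ∈ s
    · simp [hx]
    · have : f x = hf.mk f x := by by_contra h; exact hx (hs h)
      simp [hx, this]
  · filter_upwards [hf.ae_eq_mk, measure_eq_zero_iff_ae_notMem.1 hs0] with x hx hxs
    simp [hxs, hx]

/-- Borell–Brascamp–Lieb inequality. `AEMeasurable` with respect to Lebesgue measure is
Lebesgue measurability; `Function.support f` is the set where `f` does not vanish; the integrals
are Lebesgue integrals with values in `[0, ∞]`. -/
theorem corollary1p4 (n : ℕ) (hn : 1 ≤ n)
    (γ : EReal) (hγ : ((-1 / (n : ℝ) : ℝ) : EReal) ≤ γ)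
    (lam : ℝ) (hlam : lam ∈ Set.Icc (0 : ℝ) 1)
    (f g h : (Fin n → ℝ) → ℝ≥0)
    (hf : AEMeasurable f volume) (hg : AEMeasurable g volume) (hh : AEMeasurable h volume)
    (hf0 : (Function.support f).Nonempty) (hg0 : (Function.support g).Nonempty)
    (hfgh : ∀ x ∈ Function.support f, ∀ y ∈ Function.support g,
      sMean γ lam (f x : ℝ≥0∞) (g y : ℝ≥0∞) ≤ (h ((1 - lam) • x + lam • y) : ℝ≥0∞)) :
    sMean (bblExponent n γ) lam (∫⁻ x, (f x : ℝ≥0∞)) (∫⁻ x, (g x : ℝ≥0∞))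
      ≤ ∫⁻ x, (h x : ℝ≥0∞) := by
  obtain ⟨h', hm', hle', hint'⟩ := hh.coe_nnreal_ennreal.exists_measurable_ge
  rw [← hint']
  have H : ∀ x y, (f x : ℝ≥0∞) ≠ 0 → (g y : ℝ≥0∞) ≠ 0 →
      sMean γ lam (f x) (g y) ≤ h' ((1 - lam) • x + lam • y) := fun x y hx hy =>
    (hfgh x (by simpa using hx) y (by simpa using hy)).trans (hle' _)
  have Hsymm : ∀ y x, (g y : ℝ≥0∞) ≠ 0 → (f x : ℝ≥0∞) ≠ 0 →
      sMean γ (1 - lam) (g y) (f x) ≤ h' ((1 - (1 - lam)) • y + (1 - lam) • x) := by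
    intro y x hy hx
    rw [← sMean_swap, sub_sub_cancel, add_comm]
    exact H x y hx hy
  have hf0' : ∃ x, (f x : ℝ≥0∞) ≠ 0 := hf0.imp fun x hx => by simpa using hx
  have hg0' : ∃ x, (g x : ℝ≥0∞) ≠ 0 := hg0.imp fun x hx => by simpa using hx
  rcases hlam.2.eq_or_lt with h1 | h1
  · exact sMean_lintegral_le_of_degenerate hn hγ hm' hf0' H (Or.inl h1)
  rcases hlam.1.eq_or_lt with h0 | h0
  · rw [sMean_swap]
    exact sMean_lintegral_le_of_degenerate hn hγ hm' hg0' Hsymm (Or.inl (by rw [← h0, sub_zero]))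
  rcases eq_or_ne (∫⁻ x, (f x : ℝ≥0∞)) 0 with hfi | hfi
  · exact sMean_lintegral_le_of_degenerate hn hγ hm' hf0' H (Or.inr ⟨⟨h0, h1⟩, hfi⟩)
  rcases eq_or_ne (∫⁻ x, (g x : ℝ≥0∞)) 0 with hgi | hgi
  · rw [sMean_swap]
    exact sMean_lintegral_le_of_degenerate hn hγ hm' hg0' Hsymm
      (Or.inr ⟨⟨sub_pos.2 h1, sub_lt_self _ h0⟩, hgi⟩)
  -- Measurable minorants with the same integrals keep the hypothesis, because the means are
  -- monotone and the supports shrink.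
  obtain ⟨f', hfm, hfle, hfe⟩ := exists_measurable_le_lintegral_eq (μ := volume)
    fun x => (f x : ℝ≥0∞)
  obtain ⟨g', hgm, hgle, hge⟩ := exists_measurable_le_lintegral_eq (μ := volume)
    fun x => (g x : ℝ≥0∞)
  rw [hfe] at hfi ⊢
  rw [hge] at hgi ⊢
  refine borellBrascampLieb_pi ⟨h0, h1⟩ hn hγ f' g' h' hfm hgm hm' (fun x y hx hy => ?_) hfi hgi
  exact (sMean_mono γ hlam (hfle x) (hgle y)).trans
    (H x y (hx.bot_lt.trans_le (hfle x)).ne' (hy.bot_lt.trans_le (hgle y)).ne')
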